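/- Let $X$ and $Y$ be (real or complex) Banach spaces, $S\colon X\to Y$ a continuous linear mapping, $F\subset X$ convex, and $n\in\mathbb N=\{1,2,\dots\}$. Let $X'$ denote the space of continuous linear functionals $X\to\mathbb R$; if $X$ is complex, it is regarded as a real space for this purpose, so that measurements are real-valued and real-linear. For $m\in\mathbb N_0$, a *deterministic non-adaptive algorithm with $m$ measurements* is a mapping $A\colon F\to Y$ of the form $A(f)=\phi(L_1(f),\dots,L_m(f))$ with $L_1,\dots,L_m\in X'$ and an arbitrary $\phi\colon\mathbb R^m\to Y$. A *deterministic adaptive algorithm with $m$ measurements* is a mapping $A=\phi\circ N_m\colon F\to Y$ with arbitrary $\phi\colon\mathbb R^m\to Y$, where $N_m$ is given recursively by $N_k(f)=(N_{k-1}(f),L_k(f))$ and $L_k=L_k(\,\cdot\,;N_{k-1}(f))\in X'$ is chosen by an arbitrary rule depending on the previous measurements $N_{k-1}(f)\in\mathbb R^{k-1}$. A *randomized algorithm with $m$ measurements* is a family $A=(A^\omega)_{\omega\in\Omega}$ of deterministic adaptive algorithms with $m$ measurements, indexed by a probability space $(\Omega,\mathcal A,\mathbb P)$, such that $(f,\omega)\mapsto\|S(f)-A^\omega(f)\|_Y$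 is measurable with respect to $\mathcal B_F\otimes\mathcal A$; here $\mathcal B_F$ is the Borel $\sigma$-algebra on $F$ of the topology induced by the semi-norm with unit ball $F-F$ (the Minkowski functional of $F-F$). The minimal worst-case errors are $$e_m^{\text{det-non}}(S,F)=\inf_A\,\sup_{f\in F}\|S(f)-A(f)\|_Y,\qquad e_m^{\text{ran}}(S,F)=\inf_A\,\sup_{f\in F}\mathbb E\,\|S(f)-A^\omega(f)\|_Y,$$ with values in $[0,\infty]$, where the infima are over all deterministic non-adaptive, respectively all randomized, algorithms with $m$ measurements. Products in $[0,\infty]$ are taken with $0\cdot\infty=0$. **Theorem.** We have $$\Big(\prod_{k<2n} e_k^{\text{det-non}}(S,F)\Big)^{1/(2n)}\le 2^{7/2}\,n^{3/2}\,\Big(\prod_{k<n} e_k^{\text{ran}}(S,F)\Big)^{1/n}$$ and, as a consequence, $$e_{2n-1}^{\text{det-non}}(S,F)\le 12\,n^{3/2}\,\Big(\prod_{k<n} e_k^{\text{ran}}(S,F)\Big)^{1/n}.$$ In special cases, the following improvements of both inequalities hold: a) if $F$ is symmetric (that is, $F=-F$), one can replace $n^{3/2}$ with $n$; b) if $Y$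 is a Hilbert space, one can replace $n^{3/2}$ with $n$; c) if $F$ is symmetric and $Y$ is a Hilbert space, one can replace $n^{3/2}$ with $n^{1/2}$; d) if $X$ is a Hilbert space and $F$ its closed unit ball, one can replace $n^{3/2}$ with $n^{1/2}$ if one also replaces the left-hand sides by $\big(\prod_{k<4n} e_k^{\text{det-non}}(S,F)\big)^{1/(4n)}$ and $e_{4n-1}^{\text{det-non}}(S,F)$, respectively. -/

import Mathlib

open scoped ENNReal Pointwise MeasureTheory

universe u v w

namespace LinearInfo

noncomputable section

/-- The norm of the normed space `E` over `𝕜` (`ℝ` or `ℂ`) comes from an inner product. Together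
with completeness this says that `E` is a Hilbert space. -/
def IsHilbertNorm (𝕜 : Type*) (E : Type*) [RCLike 𝕜] [NormedAddCommGroup E]
    [inst : NormedSpace 𝕜 E] : Prop :=
  ∃ ip : InnerProductSpace 𝕜 E, ip.toNormedSpace = inst

section Algorithms

variable {X : Type u} {Y : Type v} [NormedAddCommGroup X] [NormedSpace ℝ X]

/-- The information mapping `N_n : X → ℝ ^ n` with adaptive choice of functionals, given by
`N_{k+1}(f) = (N_k(f), L_k(f))`, where `L_k = L k (N_k(f))` is a continuous linear functional
chosen by an arbitrary rule from the `k` measurements made so far. -/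
def adaptiveInfo (L : (k : ℕ) → (Fin k → ℝ) → StrongDual ℝ X) : (n : ℕ) → X → (Fin n → ℝ)
  | 0, _ => Fin.elim0
  | k + 1, f =>
      Fin.snoc (α := fun _ => ℝ) (adaptiveInfo L k f) (L k (adaptiveInfo L k f) f)

/-- `A : F → Y` is a deterministic algorithm using `n` adaptively chosen measurements:
`A = φ ∘ N` with an arbitrary reconstruction mapping `φ`. -/
def IsAdaptiveAlg (F : Set X) (n : ℕ) (A : F → Y) : Prop :=
  ∃ (L : (k : ℕ) → (Fin k → ℝ) → StrongDual ℝ X) (φ : (Fin n → ℝ) → Y),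
    ∀ f : F, A f = φ (adaptiveInfo L n f)

/-- `A : F → Y` is a deterministic non-adaptive algorithm: `A = φ ∘ (L_1, …, L_n)` with fixed
continuous linear functionals and an arbitrary reconstruction mapping `φ`. -/
def IsNonadaptiveAlg (F : Set X) (n : ℕ) (A : F → Y) : Prop :=
  ∃ (L : Fin n → StrongDual ℝ X) (φ : (Fin n → ℝ) → Y),
    ∀ f : F, A f = φ (fun i => L i f)

/-- The topology on the convex set `F` associated with `F`: the one of the semi-norm whose unit
ball is `F - F`, that is, of the Minkowski functional of `F - F`. (Differences of points of `F`
lie in `F - F`, so the Minkowski functional is only evaluated where it is finite.) -/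
@[reducible]
def topologyOf (F : Set X) : TopologicalSpace F where
  IsOpen U := ∀ f ∈ U, ∃ ε > 0, ∀ g : F, gauge (F - F) ((g : X) - (f : X)) < ε → g ∈ U
  isOpen_univ := fun _ _ => ⟨1, one_pos, fun _ _ => trivial⟩
  isOpen_inter := by
    intro U V hU hV f hf
    obtain ⟨a, ha, hUa⟩ := hU f hf.1
    obtain ⟨b, hb, hVb⟩ := hV f hf.2
    exact ⟨min a b, lt_min ha hb, fun g hg =>
      ⟨hUa g (hg.trans_le (min_le_left a b)), hVb g (hg.trans_le (min_le_right a b))⟩⟩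
  isOpen_sUnion := by
    intro s hs f hf
    obtain ⟨U, hUs, hfU⟩ := hf
    obtain ⟨a, ha, h⟩ := hs U hUs f hfU
    exact ⟨a, ha, fun g hg => ⟨U, hUs, h g hg⟩⟩

/-- The Borel σ-algebra on `F` of the topology associated with `F`. -/
@[reducible]
def borelOf (F : Set X) : MeasurableSpace F := @borel F (topologyOf F)

variable [NormedAddCommGroup Y]

/-- A randomized (possibly adaptive) algorithm for approximating `S` over `F` with `n`
measurements: a family of deterministic adaptive algorithms indexed by a probability space, such
that the error `(f, ω) ↦ ‖S f - A^ω f‖` is jointly measurable. -/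
structure RandomizedAlg (S : X → Y) (F : Set X) (n : ℕ) where
  Ω : Type w
  [mΩ : MeasurableSpace Ω]
  P : MeasureTheory.Measure Ω
  [isProb : MeasureTheory.IsProbabilityMeasure P]
  A : Ω → F → Y
  adaptive : ∀ ω, IsAdaptiveAlg F n (A ω)
  measurable : Measurable[(borelOf F).prod mΩ] (fun p : F × Ω => ‖S (p.1 : X) - A p.2 p.1‖)

attribute [instance] RandomizedAlg.mΩ RandomizedAlg.isProb

/-- Worst-case error `sup_{f ∈ F} ‖S f - A f‖` of a deterministic algorithm. -/
def detError (S : X → Y) (F : Set X) (A : F → Y) : ℝ≥0∞ :=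
  ⨆ f : F, ‖S (f : X) - A f‖ₑ

/-- Worst-case error `sup_{f ∈ F} 𝔼 ‖S f - A f‖` of a randomized algorithm. -/
def RandomizedAlg.error {S : X → Y} {F : Set X} {n : ℕ} (R : RandomizedAlg.{u, v, w} S F n) :
    ℝ≥0∞ :=
  ⨆ f : F, MeasureTheory.lintegral R.P (fun ω => ‖S (f : X) - R.A ω f‖ₑ)

/-- The `n`-th minimal worst-case error of deterministic non-adaptive algorithms. -/
def eDetNon (S : X → Y) (F : Set X) (n : ℕ) : ℝ≥0∞ :=
  ⨅ A : {A : F → Y // IsNonadaptiveAlg F n A}, detError S F A.1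

/-- The `n`-th minimal worst-case error of randomized (adaptive) algorithms. The probability
spaces range over the universe `w`, which is arbitrary. -/
def eRan (S : X → Y) (F : Set X) (n : ℕ) : ℝ≥0∞ :=
  ⨅ R : RandomizedAlg.{u, v, w} S F n, R.error

end Algorithms

/-- The geometric mean `(∏_{k < m} a_k)^{1/m}` in `[0, ∞]` (where `0 * ∞ = 0`). -/
def geomMean (m : ℕ) (a : ℕ → ℝ≥0∞) : ℝ≥0∞ :=
  (∏ k ∈ Finset.range m, a k) ^ (1 / (m : ℝ))

end

end LinearInfo

namespace LinearInfo

open MeasureTheory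

/-! Two estimates meet in one determinant. Deterministic side: choose pairs `f j`, `g j` in `F`
greedily, with `u j = f j - g j` annihilated by the norming functionals `l i` of `S (u i)`, `i < j`,
composed with `S`. These are `j` fixed measurements, so `‖S (u j)‖` can be taken above any number
below the `j`-th non-adaptive error. The matrix `l i (S (u j))` is triangular with diagonal `‖S (u
j)‖`, so its determinant dominates the product of those numbers (`exists_greedy_pairs`,
`prod_eDetNon_le`). Randomized side: if `F` contains an affine image of a `d`-dimensional Euclidean
unit ball on which `S` expands by at least `σ`, then `k` measurements leave error at least `σ (d -
k) / d` (`le_eRan_of_ball`). This is proved by averaging over a thin shell and slicing along each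
measurement. The link: the determinant is the product of the singular values of `T = B ∘ S ∘ U`,
where `U` carries a ball of radius `ρ` into `F` up to translation and `‖B‖ ≤ β`. Taking `d = 2k + 1`
on the leading singular directions, the singular value of index `2k` is at most `2β/ρ` times the
`k`-th randomized error (`prod_le_sq_prod_eRan`). The cases of the theorem differ only in `β`, `ρ`
and the number of functionals spent per pair. -/

/-- Adaptive algorithms, described by their decision tree: the first measurement `L` is fixed, and
on every fibre of `L` the map agrees with an adaptive algorithm using one measurement less. -/
def IsTreeAlg {E Y : Type*} [AddCommGroup E] [Module ℝ E] : ℕ → (E → Y) → Prop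
  | 0, A => ∃ a, ∀ x, A x = a
  | k + 1, A => ∃ L : E →ₗ[ℝ] ℝ, ∀ y, ∃ A' : E → Y, IsTreeAlg k A' ∧ ∀ x, L x = y → A x = A' x

/-! ### Decision trees and affine substitution -/

section Tree

variable {E E' Y Y' : Type*} [AddCommGroup E] [Module ℝ E] [AddCommGroup E'] [Module ℝ E']

theorem IsTreeAlg.postcomp (h : Y → Y') {k : ℕ} {A : E → Y} (hA : IsTreeAlg k A) :
    IsTreeAlg k (fun x => h (A x)) := by
  induction k generalizing A with
  | zero => obtain ⟨a, ha⟩ := hA; exact ⟨h a, fun x => congrArg h (ha x)⟩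
  | succ k ih =>
    obtain ⟨L, hL⟩ := hA
    refine ⟨L, fun y => ?_⟩
    obtain ⟨A', hA', hAA'⟩ := hL y
    exact ⟨_, ih hA', fun x hx => congrArg h (hAA' x hx)⟩

/-- A measurement splits as `L (c + ι x) = L c + L (ι x)`, so fibres pull back to fibres, with
values shifted by `L c`. -/
theorem IsTreeAlg.precomp_affine (c : E) (ι : E' →ₗ[ℝ] E) {k : ℕ} {A : E → Y}
    (hA : IsTreeAlg k A) : IsTreeAlg k (fun x => A (c + ι x)) := by
  induction k generalizing A with
  | zero => obtain ⟨a, ha⟩ := hA; exact ⟨a, fun x => ha _⟩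
  | succ k ih =>
    obtain ⟨L, hL⟩ := hA
    refine ⟨L ∘ₗ ι, fun y => ?_⟩
    obtain ⟨A', hA', hAA'⟩ := hL (L c + y)
    refine ⟨_, ih hA', fun x hx => hAA' _ ?_⟩
    rw [map_add, ← hx, LinearMap.comp_apply]

end Tree

theorem isTreeAlg_comp_adaptiveInfo {X Y : Type*} [NormedAddCommGroup X] [NormedSpace ℝ X]
    (L : (k : ℕ) → (Fin k → ℝ) → StrongDual ℝ X) (n : ℕ) (φ : (Fin n → ℝ) → Y) :
    IsTreeAlg n (fun f => φ (adaptiveInfo L n f)) := by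
  have key : ∀ k j (hjk : j + k = n) (y : Fin j → ℝ), ∃ A' : X → Y, IsTreeAlg k A' ∧
      ∀ f, adaptiveInfo L j f = y → φ (adaptiveInfo L n f) = A' f := by
    intro k
    induction k with
    | zero =>
      rintro j rfl y
      exact ⟨fun _ => φ y, ⟨φ y, fun _ => rfl⟩, fun f hf => by
        change φ (adaptiveInfo L j f) = _
        rw [hf]⟩
    | succ k ih =>
      intro j hjk y
      choose B hB hBf using fun t : ℝ =>
        ih (j + 1) (by omega) (Fin.snoc (α := fun _ => ℝ) y t)
      -- The subtrees are glued along the value of the next measurement.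
      refine ⟨fun f => B (L j y f) f, ⟨(L j y).toLinearMap, fun t => ⟨B t, hB t, ?_⟩⟩, ?_⟩
      · rintro x rfl
        rfl
      · rintro f rfl
        exact hBf _ f rfl
  obtain ⟨A', hA', h⟩ := key n 0 (by omega) (Fin.elim0)
  have : (fun f => φ (adaptiveInfo L n f)) = A' := funext fun f => h f (Subsingleton.elim _ _)
  rwa [this]

/-! ### Rotation invariant averages and hyperplane slices -/

section Slicing

theorem exists_orthonormalBasis_apply_zero_eq {H : Type*} [NormedAddCommGroup H]
    [InnerProductSpace ℝ H] {d : ℕ} (h : Module.finrank ℝ H = d + 1) {e : H} (he : ‖e‖ = 1) :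
    ∃ b : OrthonormalBasis (Fin (d + 1)) ℝ H, b 0 = e := by
  have : FiniteDimensional ℝ H := Module.finite_of_finrank_eq_succ h
  obtain ⟨b, hb⟩ := Orthonormal.exists_orthonormalBasis_extension_of_card_eq
    (𝕜 := ℝ) (E := H) (ι := Fin (d + 1)) (by simpa using h) (v := fun _ => e) (s := {0})
    ⟨fun i => by simpa using he, fun i j hij => absurd (Subsingleton.elim i j) hij⟩
  exact ⟨b, hb 0 rfl⟩

theorem exists_linearIsometryEquiv_apply_eq {H₁ H₂ : Type*} [NormedAddCommGroup H₁]
    [InnerProductSpace ℝ H₁] [NormedAddCommGroup H₂] [InnerProductSpace ℝ H₂] {d : ℕ}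
    (h₁ : Module.finrank ℝ H₁ = d + 1) (h₂ : Module.finrank ℝ H₂ = d + 1) {e : H₁} {v : H₂}
    (he : ‖e‖ = 1) (hv : ‖v‖ = 1) : ∃ Φ : H₁ ≃ₗᵢ[ℝ] H₂, Φ e = v := by
  obtain ⟨b, hb⟩ := exists_orthonormalBasis_apply_zero_eq h₁ he
  obtain ⟨b', hb'⟩ := exists_orthonormalBasis_apply_zero_eq h₂ hv
  exact ⟨b.equiv b' (Equiv.refl _), by rw [← hb, ← hb']; simp⟩

/-- Cavalieri's principle for the hyperplanes orthogonal to a unit vector `v`. -/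
theorem exists_slicing {d : ℕ} {v : EuclideanSpace ℝ (Fin (d + 1))} (hv : ‖v‖ = 1) :
    ∃ ι : EuclideanSpace ℝ (Fin d) →ₗᵢ[ℝ] EuclideanSpace ℝ (Fin (d + 1)),
      (∀ z, inner ℝ v (ι z) = 0) ∧
      (∀ t z, ‖t • v + ι z‖ ^ 2 = t ^ 2 + ‖z‖ ^ 2) ∧
      ∀ g : EuclideanSpace ℝ (Fin (d + 1)) → ℝ≥0∞, Measurable g →
        ∫⁻ x, g x = ∫⁻ t : ℝ, ∫⁻ z, g (t • v + ι z) := by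
  -- An isometry from the `ℓ²`-product of `ℝ` and `ℝ^d` taking `(1, 0)` to `v` reduces slicing to
  -- Tonelli.
  obtain ⟨Φ, hΦ⟩ := exists_linearIsometryEquiv_apply_eq
    (H₁ := WithLp 2 (ℝ × EuclideanSpace ℝ (Fin d))) (e := WithLp.toLp 2 ((1 : ℝ), 0))
    (d := d) (by
      rw [LinearEquiv.finrank_eq (WithLp.linearEquiv 2 ℝ (ℝ × EuclideanSpace ℝ (Fin d)))]
      simp [add_comm]) (by simp) (by simp) hv
  let j : EuclideanSpace ℝ (Fin d) →ₗᵢ[ℝ] WithLp 2 (ℝ × EuclideanSpace ℝ (Fin d)) :=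
    { toLinearMap := (WithLp.linearEquiv 2 ℝ (ℝ × EuclideanSpace ℝ (Fin d))).symm.toLinearMap ∘ₗ
        LinearMap.inr ℝ ℝ (EuclideanSpace ℝ (Fin d))
      norm_map' := fun z => by simp }
  have hj : ∀ z, j z = WithLp.toLp 2 ((0 : ℝ), z) := fun z => rfl
  have hJ : ∀ (t : ℝ) z, t • v + Φ (j z) = Φ (WithLp.toLp 2 (t, z)) := by
    intro t z
    rw [← hΦ, ← map_smul, ← map_add, hj, ← WithLp.toLp_smul, ← WithLp.toLp_add]
    simp
  refine ⟨Φ.toLinearIsometry.comp j, fun z => ?_, fun t z => ?_, fun g hg => ?_⟩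
  · simp only [LinearIsometry.coe_comp, LinearIsometryEquiv.coe_toLinearIsometry,
      Function.comp_apply]
    rw [← hΦ, Φ.inner_map_map, hj]
    simp [WithLp.prod_inner_apply]
  · simp only [LinearIsometry.coe_comp, LinearIsometryEquiv.coe_toLinearIsometry,
      Function.comp_apply]
    rw [hJ, Φ.norm_map, WithLp.prod_norm_sq_eq_of_L2]
    simp
  · simp only [LinearIsometry.coe_comp, LinearIsometryEquiv.coe_toLinearIsometry,
      Function.comp_apply, hJ]
    have hmp := (Φ.measurePreserving).comp
      (WithLp.volume_preserving_toLp ℝ (EuclideanSpace ℝ (Fin d)))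
    rw [← hmp.lintegral_comp hg, Measure.volume_eq_prod, lintegral_prod]
    · rfl
    · exact (hg.comp hmp.measurable).aemeasurable

variable {d : ℕ} {ω : ℝ → ℝ≥0∞}

theorem lintegral_coord_sq_mul_radial (i j : Fin d) :
    ∫⁻ x : EuclideanSpace ℝ (Fin d), ENNReal.ofReal (x i ^ 2) * ω (‖x‖ ^ 2) =
      ∫⁻ x : EuclideanSpace ℝ (Fin d), ENNReal.ofReal (x j ^ 2) * ω (‖x‖ ^ 2) := by
  let Φ := LinearIsometryEquiv.piLpCongrLeft 2 ℝ ℝ (Equiv.swap i j)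
  rw [← (Φ.measurePreserving).lintegral_comp_emb Φ.toHomeomorph.measurableEmbedding]
  refine lintegral_congr fun x => ?_
  rw [Φ.norm_map]
  simp [Φ, LinearIsometryEquiv.piLpCongrLeft_apply, Equiv.piCongrLeft'_apply]

/-- All `d + 1` squared coordinates have the same integral, and slicing drops one of them. This
exact ratio is why averages are weighted by `‖x‖ ^ 2` rather than `‖x‖`. -/
theorem lintegral_lintegral_normSq_mul_radial (hω : Measurable ω) :
    ((d + 1 : ℕ) : ℝ≥0∞) * ∫⁻ t : ℝ, ∫⁻ z : EuclideanSpace ℝ (Fin d),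
        ENNReal.ofReal (‖z‖ ^ 2) * ω (t ^ 2 + ‖z‖ ^ 2) =
      d * ∫⁻ x : EuclideanSpace ℝ (Fin (d + 1)), ENNReal.ofReal (‖x‖ ^ 2) * ω (‖x‖ ^ 2) := by
  have hv : ‖(EuclideanSpace.single 0 1 : EuclideanSpace ℝ (Fin (d + 1)))‖ = 1 := by simp
  obtain ⟨ι, h1, h2, h3⟩ := exists_slicing hv
  have hm : ∀ i : Fin (d + 1), Measurable fun x : EuclideanSpace ℝ (Fin (d + 1)) =>
      ENNReal.ofReal (x i ^ 2) * ω (‖x‖ ^ 2) := fun i => by fun_prop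
  set I := ∫⁻ x : EuclideanSpace ℝ (Fin (d + 1)), ENNReal.ofReal (x 0 ^ 2) * ω (‖x‖ ^ 2) with hI
  have hsum : ∀ s : Finset (Fin (d + 1)), ∫⁻ x : EuclideanSpace ℝ (Fin (d + 1)),
      ENNReal.ofReal (∑ i ∈ s, x i ^ 2) * ω (‖x‖ ^ 2) = s.card * I := by
    intro s
    simp_rw [ENNReal.ofReal_sum_of_nonneg (fun i _ => sq_nonneg _), Finset.sum_mul]
    rw [lintegral_finsetSum _ fun i _ => hm i]
    rw [Finset.sum_congr rfl fun i _ => lintegral_coord_sq_mul_radial i 0]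
    simp [hI]
  have hA : ∫⁻ x : EuclideanSpace ℝ (Fin (d + 1)), ENNReal.ofReal (‖x‖ ^ 2) * ω (‖x‖ ^ 2)
      = (d + 1 : ℕ) * I := by
    have := hsum Finset.univ
    simpa [EuclideanSpace.norm_sq_eq] using this
  have hB : ∫⁻ t : ℝ, ∫⁻ z : EuclideanSpace ℝ (Fin d),
        ENNReal.ofReal (‖z‖ ^ 2) * ω (t ^ 2 + ‖z‖ ^ 2) = d * I := by
    have := hsum (Finset.univ.erase 0)
    rw [h3 _ (by fun_prop)] at this
    rw [Finset.card_erase_of_mem (Finset.mem_univ _), Finset.card_univ, Fintype.card_fin,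
      Nat.add_sub_cancel] at this
    rw [← this]
    refine lintegral_congr fun t => lintegral_congr fun z => ?_
    rw [h2]
    congr 2
    have e1 : (t • EuclideanSpace.single 0 1 + ι z : EuclideanSpace ℝ (Fin (d + 1))) 0 = t := by
      have := h1 z
      rw [EuclideanSpace.inner_single_left] at this
      simp at this
      simp [this]
    have e2 := h2 t z
    rw [EuclideanSpace.norm_sq_eq, ← Finset.add_sum_erase _ _ (Finset.mem_univ 0), e1] at e2
    simp only [Real.norm_eq_abs, sq_abs] at e2
    linarith
  rw [hA, hB]
  ring

/-- Average error of an adaptive algorithm with respect to a rotation invariant weight on the unit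
ball. -/
theorem lintegral_error_lower_bound {Y : Type*} [NormedAddCommGroup Y] [NormedSpace ℝ Y] {σ : ℝ}
    (k : ℕ) (hω : Measurable ω) (hω1 : ∀ s, 1 < s → ω s = 0)
    (T : EuclideanSpace ℝ (Fin d) →ₗ[ℝ] Y) (hT : ∀ x, σ * ‖x‖ ≤ ‖T x‖)
    {A : EuclideanSpace ℝ (Fin d) → Y} (hA : IsTreeAlg k A)
    {g : EuclideanSpace ℝ (Fin d) → ℝ≥0∞} (hg : Measurable g)
    (hgA : ∀ x, ‖T x - A x‖ₑ * ω (‖x‖ ^ 2) ≤ g x) :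
    ((d - k : ℕ) : ℝ≥0∞) * ENNReal.ofReal σ * ∫⁻ x : EuclideanSpace ℝ (Fin d),
      ENNReal.ofReal (‖x‖ ^ 2) * ω (‖x‖ ^ 2) ≤ d * ∫⁻ x, g x := by
  induction k generalizing d ω with
  | zero =>
    obtain ⟨a, ha⟩ := hA
    rw [Nat.sub_zero, mul_assoc]
    gcongr
    -- A constant output `a` cannot suit both `x` and `-x`: the two errors add up to at least `2 ‖T
    -- x‖`, and `‖x‖ ^ 2 ≤ ‖x‖` on the unit ball.
    have hneg : ∫⁻ x, g (-x) = ∫⁻ x, g x :=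
      (Measure.measurePreserving_neg (volume : Measure (EuclideanSpace ℝ (Fin d)))).lintegral_comp
        hg
    have h2 : 2 * (ENNReal.ofReal σ * ∫⁻ x : EuclideanSpace ℝ (Fin d),
        ENNReal.ofReal (‖x‖ ^ 2) * ω (‖x‖ ^ 2)) ≤ 2 * ∫⁻ x, g x := by
      rw [two_mul (∫⁻ x, g x)]
      nth_rewrite 2 [← hneg]
      rw [← lintegral_add_left hg, ← lintegral_const_mul' _ _ ENNReal.ofReal_ne_top,
        ← lintegral_const_mul' _ _ (by simp)]
      refine lintegral_mono fun x => ?_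
      by_cases hx : 1 < ‖x‖ ^ 2
      · simp [hω1 _ hx]
      have hx1 : ‖x‖ ≤ 1 := by
        by_contra h
        push Not at h
        exact hx (by nlinarith)
      have h1 := hgA x
      have h2 := hgA (-x)
      rw [ha] at h1 h2
      rw [norm_neg] at h2
      refine le_trans ?_ (add_le_add h1 h2)
      rw [← add_mul, ← mul_assoc, ← mul_assoc]
      gcongr
      have e1 : 2 * (σ * ‖x‖ ^ 2) ≤ ‖T x - a‖ + ‖T (-x) - a‖ := by
        have := norm_sub_le (T x - a) (T (-x) - a)
        have e : T x - a - (T (-x) - a) = (2 : ℝ) • T x := by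
          rw [map_neg, two_smul]; abel
        rw [e, norm_smul, Real.norm_ofNat] at this
        rcases le_or_gt σ 0 with hσ | hσ
        · have : σ * ‖x‖ ^ 2 ≤ 0 := mul_nonpos_of_nonpos_of_nonneg hσ (sq_nonneg _)
          have := norm_nonneg (T x - a)
          have := norm_nonneg (T (-x) - a)
          linarith
        · have : σ * ‖x‖ ^ 2 ≤ σ * ‖x‖ := by
            gcongr
            nlinarith [norm_nonneg x]
          linarith [hT x]
      rw [mul_assoc, ← ENNReal.ofReal_mul' (sq_nonneg _), ← ofReal_norm, ← ofReal_norm,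
        ← ENNReal.ofReal_add (norm_nonneg _) (norm_nonneg _)]
      refine le_trans (le_of_eq ?_) (ENNReal.ofReal_le_ofReal e1)
      rw [ENNReal.ofReal_mul zero_le_two, ENNReal.ofReal_ofNat]
    exact (ENNReal.mul_le_mul_iff_right (by simp) (by simp)).1 h2
  | succ k ih =>
    cases d with
    | zero => simp
    | succ d =>
      obtain ⟨L, hL⟩ := hA
      obtain ⟨v, hv, a, hLa⟩ : ∃ v : EuclideanSpace ℝ (Fin (d + 1)), ‖v‖ = 1 ∧
          ∃ a : ℝ, ∀ x, L x = a * inner ℝ v x := by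
        set l := (InnerProductSpace.toDual ℝ (EuclideanSpace ℝ (Fin (d + 1)))).symm
          (LinearMap.toContinuousLinearMap L) with hl
        have hlx : ∀ x, L x = inner ℝ l x := fun x => by
          rw [hl, InnerProductSpace.toDual_symm_apply]; rfl
        by_cases h0 : l = 0
        · exact ⟨EuclideanSpace.single 0 1, by simp, 0, fun x => by rw [hlx, h0]; simp⟩
        · refine ⟨‖l‖⁻¹ • l, norm_smul_inv_norm (𝕜 := ℝ) h0, ‖l‖, fun x => ?_⟩
          rw [hlx, inner_smul_left]
          simp [norm_ne_zero_iff.2 h0]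
      obtain ⟨ι, h1, h2, h3⟩ := exists_slicing hv
      -- In dimension one the left factor vanishes; otherwise `d` can be cancelled below.
      rcases Nat.eq_zero_or_pos d with rfl | hd
      · simp
      have key : ((d - k : ℕ) : ℝ≥0∞) * ENNReal.ofReal σ * (∫⁻ t : ℝ,
          ∫⁻ z : EuclideanSpace ℝ (Fin d), ENNReal.ofReal (‖z‖ ^ 2) * ω (t ^ 2 + ‖z‖ ^ 2)) ≤
          d * ∫⁻ x, g x := by
        rw [h3 g hg, ← lintegral_const_mul' _ _ (ENNReal.natCast_ne_top d),
          ← lintegral_const_mul' _ _ (ENNReal.mul_ne_top (ENNReal.natCast_ne_top _)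
            ENNReal.ofReal_ne_top)]
        refine lintegral_mono fun t => ?_
        obtain ⟨A', hA', hAA'⟩ := hL (a * t)
        -- On a slice the weight is again radial, the first measurement is constant, and the offset
        -- `T (t • v)` is absorbed into the algorithm.
        refine ih (ω := fun s => ω (t ^ 2 + s)) (by fun_prop)
          (fun s hs => hω1 _ (by nlinarith [sq_nonneg t])) (T ∘ₗ ι.toLinearMap)
          (fun x => by simpa using hT (ι x))
          ((hA'.precomp_affine (t • v) ι.toLinearMap).postcomp (fun y => y - T (t • v)))
          (hg.comp (by fun_prop)) (fun z => ?_)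
        have := hgA (t • v + ι z)
        rw [h2, hAA' _ (by
          rw [hLa, inner_add_right, h1, inner_smul_right, real_inner_self_eq_norm_sq, hv]
          ring)] at this
        refine le_trans (le_of_eq ?_) this
        congr 2
        simp only [LinearMap.comp_apply, LinearIsometry.coe_toLinearMap, map_add]
        abel
      have hd' : (d : ℝ≥0∞) ≠ 0 := by simp; omega
      rw [← ENNReal.mul_le_mul_iff_right hd' (by simp)]
      -- The factors telescope: `(d - k) / d` from induction times `d / (d + 1)` from slicing.
      calc (d : ℝ≥0∞) * (((d + 1 - (k + 1) : ℕ) : ℝ≥0∞) * ENNReal.ofReal σ *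
            ∫⁻ x : EuclideanSpace ℝ (Fin (d + 1)), ENNReal.ofReal (‖x‖ ^ 2) * ω (‖x‖ ^ 2))
          = ((d - k : ℕ) : ℝ≥0∞) * ENNReal.ofReal σ * (d * ∫⁻ x : EuclideanSpace ℝ (Fin (d + 1)),
              ENNReal.ofReal (‖x‖ ^ 2) * ω (‖x‖ ^ 2)) := by
            rw [Nat.add_sub_add_right]; ring
        _ = ((d + 1 : ℕ) : ℝ≥0∞) * (((d - k : ℕ) : ℝ≥0∞) * ENNReal.ofReal σ * (∫⁻ t : ℝ,
              ∫⁻ z : EuclideanSpace ℝ (Fin d),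
                ENNReal.ofReal (‖z‖ ^ 2) * ω (t ^ 2 + ‖z‖ ^ 2))) := by
            rw [← lintegral_lintegral_normSq_mul_radial hω]; ring
        _ ≤ ((d + 1 : ℕ) : ℝ≥0∞) * (d * ∫⁻ x, g x) := by gcongr
        _ = d * (((d + 1 : ℕ) : ℝ≥0∞) * ∫⁻ x, g x) := by ring

end Slicing

/-! ### Averaging over a spherical shell -/

section Shell

variable {d : ℕ} {δ : ℝ}

/-- The weight describing, as a function of `‖x‖ ^ 2`, a spherical shell with outer radius one. -/
noncomputable def shellWeight (δ : ℝ) : ℝ → ℝ≥0∞ := (Set.Icc δ 1).indicator 1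

theorem measurable_shellWeight : Measurable (shellWeight δ) :=
  measurable_one.indicator measurableSet_Icc

theorem lintegral_shellWeight_ne_zero (hd : 0 < d) (hδ0 : 0 < δ) (hδ : δ < 1) :
    ∫⁻ x : EuclideanSpace ℝ (Fin d), shellWeight δ (‖x‖ ^ 2) ≠ 0 := by
  have : Nonempty (Fin d) := ⟨⟨0, hd⟩⟩
  let U : Set (EuclideanSpace ℝ (Fin d)) := {x | ‖x‖ ^ 2 ∈ Set.Ioo δ 1}
  have hU : IsOpen U := isOpen_Ioo.preimage (by fun_prop)
  have hUn : U.Nonempty := by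
    obtain ⟨r, hr⟩ := exists_between hδ
    refine ⟨EuclideanSpace.single ⟨0, hd⟩ √r, ?_⟩
    simp only [U, Set.mem_ofPred_eq, PiLp.norm_single, Real.norm_eq_abs, sq_abs]
    rwa [Real.sq_sqrt (hδ0.trans hr.1).le]
  have h1 : volume U ≤ ∫⁻ x : EuclideanSpace ℝ (Fin d), shellWeight δ (‖x‖ ^ 2) := by
    rw [← lintegral_indicator_one hU.measurableSet]
    refine lintegral_mono fun x => ?_
    by_cases hx : x ∈ U
    · have : ‖x‖ ^ 2 ∈ Set.Icc δ 1 := Set.Ioo_subset_Icc_self hx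
      simp [shellWeight, this, hx]
    · simp [hx]
  exact ((hU.measure_pos volume hUn).trans_le h1).ne'

theorem lintegral_shellWeight_ne_top (δ : ℝ) :
    ∫⁻ x : EuclideanSpace ℝ (Fin d), shellWeight δ (‖x‖ ^ 2) ≠ ∞ := by
  have h1 : ∫⁻ x : EuclideanSpace ℝ (Fin d), shellWeight δ (‖x‖ ^ 2) ≤
      volume (Metric.closedBall (0 : EuclideanSpace ℝ (Fin d)) 1) := by
    rw [← lintegral_indicator_one Metric.isClosed_closedBall.measurableSet]
    refine lintegral_mono fun x => ?_
    by_cases hx : ‖x‖ ^ 2 ∈ Set.Icc δ 1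
    · have : ‖x‖ ≤ 1 := (sq_le_one_iff₀ (norm_nonneg x)).1 hx.2
      simp [shellWeight, hx, this]
    · simp [shellWeight, hx]
  exact (h1.trans_lt measure_closedBall_lt_top).ne

/-- A worst-case error is bounded below by an average error. -/
theorem le_of_forall_mul_lintegral_le_lintegral {α Ω : Type*} [MeasurableSpace α]
    [MeasurableSpace Ω] {μ : Measure α} [SFinite μ] {P : Measure Ω} [IsProbabilityMeasure P]
    {err : α → Ω → ℝ≥0∞} (herr : Measurable (Function.uncurry err)) {ρ : α → ℝ≥0∞}
    (hρ : Measurable ρ) (h0 : ∫⁻ x, ρ x ∂μ ≠ 0) (htop : ∫⁻ x, ρ x ∂μ ≠ ∞) {a b e : ℝ≥0∞}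
    (ha : ∀ w, a * ∫⁻ x, ρ x ∂μ ≤ b * ∫⁻ x, err x w * ρ x ∂μ)
    (he : ∀ x, ∫⁻ w, err x w ∂P ≤ e) : a ≤ b * e := by
  rw [← ENNReal.mul_le_mul_iff_left h0 htop]
  have hm : Measurable fun p : Ω × α => err p.2 p.1 * ρ p.2 :=
    (herr.comp measurable_swap).mul (hρ.comp measurable_snd)
  calc a * ∫⁻ x, ρ x ∂μ = ∫⁻ _w : Ω, a * ∫⁻ x, ρ x ∂μ ∂P := by
        rw [lintegral_const, measure_univ, mul_one]
    _ ≤ ∫⁻ w, b * (∫⁻ x, err x w * ρ x ∂μ) ∂P := lintegral_mono ha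
    _ = b * ∫⁻ x, (∫⁻ w, err x w * ρ x ∂P) ∂μ := by
        rw [lintegral_const_mul b hm.lintegral_prod_right', lintegral_lintegral_swap hm.aemeasurable]
    _ ≤ b * ∫⁻ x, e * ρ x ∂μ := by
        gcongr with x
        rw [lintegral_mul_const _ (show Measurable (err x) from herr.comp measurable_prodMk_left)]
        gcongr
        exact he x
    _ = b * e * ∫⁻ x, ρ x ∂μ := by rw [lintegral_const_mul _ hρ, mul_assoc]

end Shell

/-! ### Lower bound for randomized algorithms -/

section Randomized

variable {X : Type u} {Y : Type v} [NormedAddCommGroup X] [NormedSpace ℝ X] {F : Set X} {d : ℕ}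
  {c : X} {ι : EuclideanSpace ℝ (Fin d) →ₗ[ℝ] X}

/-- For a unit vector, `ι z` is the difference of `c + ι z` and `c + ι 0`, both in `F`. Hence `x ↦ c
+ ι x` is 1-Lipschitz for the semi-norm of `F - F`, which gives its Borel measurability on the ball.
-/
theorem gauge_sub_le_norm (hF : ∀ x, ‖x‖ ≤ 1 → c + ι x ∈ F) (z : EuclideanSpace ℝ (Fin d)) :
    gauge (F - F) (ι z) ≤ ‖z‖ := by
  rcases eq_or_ne z 0 with rfl | hz
  · simp
  refine gauge_le_of_mem (norm_nonneg z) ⟨ι (‖z‖⁻¹ • z), ?_, ?_⟩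
  · refine ⟨_, hF (‖z‖⁻¹ • z) (norm_smul_inv_norm (𝕜 := ℝ) hz).le, _, hF 0 (by simp), ?_⟩
    simp
  · simp [smul_smul, norm_ne_zero_iff.2 hz]

open Classical in
theorem measurable_ball_param (hF : ∀ x, ‖x‖ ≤ 1 → c + ι x ∈ F) (f₀ : F) :
    Measurable[_, borelOf F] fun x : EuclideanSpace ℝ (Fin d) =>
      if h : x ∈ Metric.closedBall (0 : EuclideanSpace ℝ (Fin d)) 1 then
        (⟨c + ι x, hF x (mem_closedBall_zero_iff.1 h)⟩ : F) else f₀ := by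
  let := topologyOf F
  let := borelOf F
  have : BorelSpace F := ⟨rfl⟩
  refine Measurable.dite (s := Metric.closedBall (0 : EuclideanSpace ℝ (Fin d)) 1)
    (f := fun x => (⟨c + ι x, hF x (mem_closedBall_zero_iff.1 x.2)⟩ : F)) (g := fun _ => f₀)
    (Continuous.measurable ?_) measurable_const Metric.isClosed_closedBall.measurableSet
  refine continuous_def.2 fun U hU => Metric.isOpen_iff.2 fun x hx => ?_
  obtain ⟨ε, hε, h⟩ := hU _ hx
  refine ⟨ε, hε, fun y hy => h _ ?_⟩
  rw [Metric.mem_ball, Subtype.dist_eq, dist_eq_norm] at hy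
  refine lt_of_le_of_lt ?_ hy
  have := gauge_sub_le_norm hF ((y : EuclideanSpace ℝ (Fin d)) - x)
  simpa [map_sub] using this

variable [NormedAddCommGroup Y] [NormedSpace ℝ Y]

/-- The error is averaged over the shell `δ ≤ ‖x‖ ^ 2 ≤ 1`, where the factor `‖x‖ ^ 2` costs at most
`δ`. -/
theorem RandomizedAlg.error_lower_bound (S : X →L[ℝ] Y) {σ : ℝ} (hd : 0 < d)
    (hF : ∀ x, ‖x‖ ≤ 1 → c + ι x ∈ F) (hS : ∀ x, σ * ‖x‖ ≤ ‖S (ι x)‖) {k : ℕ}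
    (R : RandomizedAlg.{u, v, w} S F k) {δ : ℝ} (hδ0 : 0 < δ) (hδ : δ < 1) :
    ((d - k : ℕ) : ℝ≥0∞) * ENNReal.ofReal σ * ENNReal.ofReal δ ≤ d * R.error := by
  classical
  let D := Metric.closedBall (0 : EuclideanSpace ℝ (Fin d)) 1
  let f₀ : F := ⟨c + ι 0, hF 0 (by simp)⟩
  -- The default `f₀` is harmless: the weight vanishes off the unit ball.
  let q : EuclideanSpace ℝ (Fin d) → F := fun x =>
    if h : x ∈ D then (⟨c + ι x, hF x (mem_closedBall_zero_iff.1 h)⟩ : F) else f₀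
  have hq : ∀ x, ‖x‖ ≤ 1 → (q x : X) = c + ι x := fun x hx => by
    simp only [q, D, mem_closedBall_zero_iff, hx, dif_pos]
  let := borelOf F
  have hqm : Measurable q := measurable_ball_param hF f₀
  let ω := shellWeight δ
  have hω : Measurable ω := measurable_shellWeight
  have hω1 : ∀ s, 1 < s → ω s = 0 := fun s hs =>
    Set.indicator_of_notMem (fun h => absurd h.2 (not_le.2 hs)) _
  let err : EuclideanSpace ℝ (Fin d) → R.Ω → ℝ≥0∞ := fun x w => ‖S (q x : X) - R.A w (q x)‖ₑ
  have herr : Measurable (Function.uncurry err) := by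
    have h1 : Measurable fun p : EuclideanSpace ℝ (Fin d) × R.Ω =>
        ‖S (q p.1 : X) - R.A p.2 (q p.1)‖ :=
      R.measurable.comp ((hqm.comp measurable_fst).prodMk measurable_snd)
    have h2 := ENNReal.measurable_ofReal.comp h1
    convert h2 using 1
    ext p
    simp [err, Function.uncurry, ofReal_norm]
  have hwm : Measurable fun x : EuclideanSpace ℝ (Fin d) => ω (‖x‖ ^ 2) := by fun_prop
  set V := ∫⁻ x : EuclideanSpace ℝ (Fin d), ω (‖x‖ ^ 2) with hV
  have hlow : ∀ w, ((d - k : ℕ) : ℝ≥0∞) * ENNReal.ofReal σ * (ENNReal.ofReal δ * V) ≤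
      d * ∫⁻ x, err x w * ω (‖x‖ ^ 2) := by
    intro w
    obtain ⟨L, φ, hA⟩ := R.adaptive w
    refine le_trans ?_ (lintegral_error_lower_bound (σ := σ) k hω hω1 (S.toLinearMap ∘ₗ ι)
      (fun x => hS x) (((isTreeAlg_comp_adaptiveInfo L k φ).precomp_affine c ι).postcomp
        (fun y => y - S c)) (g := fun x => err x w * ω (‖x‖ ^ 2)) ?_ fun x => ?_)
    · gcongr
      rw [hV, ← lintegral_const_mul' _ _ ENNReal.ofReal_ne_top]
      refine lintegral_mono fun x => ?_
      by_cases hx : ‖x‖ ^ 2 ∈ Set.Icc δ 1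
      · gcongr
        exact hx.1
      · simp [ω, shellWeight, hx]
    · exact (herr.comp measurable_prodMk_right).mul hwm
    · by_cases hx : ‖x‖ ^ 2 ∈ Set.Icc δ 1
      · have hx1 : ‖x‖ ≤ 1 := (sq_le_one_iff₀ (norm_nonneg x)).1 hx.2
        simp only [err]
        rw [hA, hq x hx1, map_add]
        refine le_of_eq ?_
        congr 2
        simp only [LinearMap.comp_apply, ContinuousLinearMap.coe_coe]
        abel
      · simp [ω, shellWeight, hx]
  have hV0 : V ≠ 0 := lintegral_shellWeight_ne_zero hd hδ0 hδ
  have hVtop : V ≠ ∞ := lintegral_shellWeight_ne_top δ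
  refine le_of_forall_mul_lintegral_le_lintegral herr hwm hV0 hVtop (fun w => ?_)
    (fun x => le_iSup (fun f : F => ∫⁻ w, ‖S (f : X) - R.A w f‖ₑ ∂(R.P)) (q x))
  rw [mul_assoc]
  exact hlow w

/-- Randomized algorithms are bounded below by Bernstein-type numbers. -/
theorem le_eRan_of_ball (S : X →L[ℝ] Y) {σ : ℝ} (hd : 0 < d)
    (hF : ∀ x, ‖x‖ ≤ 1 → c + ι x ∈ F) (hS : ∀ x, σ * ‖x‖ ≤ ‖S (ι x)‖) (k : ℕ) :
    ((d - k : ℕ) : ℝ≥0∞) * ENNReal.ofReal σ ≤ d * eRan.{u, v, w} S F k := by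
  have hd' : (d : ℝ≥0∞) ≠ 0 := by exact_mod_cast hd.ne'
  rw [mul_comm (d : ℝ≥0∞), ← ENNReal.div_le_iff hd' (ENNReal.natCast_ne_top d)]
  refine le_iInf fun R => ?_
  rw [ENNReal.div_le_iff hd' (ENNReal.natCast_ne_top d), mul_comm _ (d : ℝ≥0∞)]
  -- Letting the shell shrink to the sphere, `δ → 1`, removes the loss.
  have ht : Filter.Tendsto (fun δ : ℝ => ((d - k : ℕ) : ℝ≥0∞) * ENNReal.ofReal σ *
      ENNReal.ofReal δ) (nhdsWithin 1 (Set.Iio 1))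
      (nhds (((d - k : ℕ) : ℝ≥0∞) * ENNReal.ofReal σ * ENNReal.ofReal 1)) :=
    ENNReal.Tendsto.const_mul
      ((ENNReal.continuous_ofReal.tendsto 1).mono_left nhdsWithin_le_nhds) (Or.inl (by simp))
  rw [ENNReal.ofReal_one, mul_one] at ht
  refine le_of_tendsto ht ?_
  filter_upwards [Ioo_mem_nhdsLT (zero_lt_one' ℝ)] with δ hδ
  exact R.error_lower_bound S hd hF hS hδ.1 hδ.2

end Randomized

/-! ### Singular values -/

section SingularValues

/-- `J` spans the eigenvectors of `T* T` for the `d` largest eigenvalues; indices start at zero, so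
the smallest singular value there has index `d - 1`. -/
theorem exists_isometry_singularValues_mul_norm_le {m d : ℕ} (hd : 0 < d) (hdm : d ≤ m)
    (T : EuclideanSpace ℝ (Fin m) →ₗ[ℝ] EuclideanSpace ℝ (Fin m)) :
    ∃ J : EuclideanSpace ℝ (Fin d) →ₗᵢ[ℝ] EuclideanSpace ℝ (Fin m),
      ∀ x, T.singularValues (d - 1) * ‖x‖ ≤ ‖T (J x)‖ := by
  have hn : Module.finrank ℝ (EuclideanSpace ℝ (Fin m)) = m := finrank_euclideanSpace_fin
  have hT := T.isSymmetric_adjoint_comp_self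
  let b : Fin d → EuclideanSpace ℝ (Fin m) := fun i => hT.eigenvectorBasis hn (Fin.castLE hdm i)
  have hb : Orthonormal ℝ b :=
    (hT.eigenvectorBasis hn).orthonormal.comp _ (Fin.castLE_injective hdm)
  have hbT : ∀ i, T.adjoint (T (b i)) = (T.singularValues i ^ 2) • b i := by
    intro i
    have h1 := hT.apply_eigenvectorBasis hn (Fin.castLE hdm i)
    rw [← T.sq_singularValues_fin hn] at h1
    exact h1
  let J₀ : EuclideanSpace ℝ (Fin d) →ₗ[ℝ] EuclideanSpace ℝ (Fin m) :=
    Fintype.linearCombination ℝ b ∘ₗ (WithLp.linearEquiv 2 ℝ (Fin d → ℝ)).toLinearMap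
  have hJ : ∀ x, J₀ x = ∑ i, x i • b i := fun x => rfl
  have hJn : ∀ x, ‖J₀ x‖ = ‖x‖ := fun x => by
    rw [← sq_eq_sq₀ (norm_nonneg _) (norm_nonneg _), ← real_inner_self_eq_norm_sq, hJ,
      hb.inner_sum, EuclideanSpace.norm_sq_eq]
    simp [sq]
  refine ⟨⟨J₀, hJn⟩, fun x => ?_⟩
  change _ ≤ ‖T (J₀ x)‖
  refine le_of_sq_le_sq ?_ (norm_nonneg _)
  rw [← real_inner_self_eq_norm_sq, ← LinearMap.adjoint_inner_left, hJ]
  simp only [map_sum, map_smul, hbT, smul_smul]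
  rw [hb.inner_sum, mul_pow, EuclideanSpace.norm_sq_eq, Finset.mul_sum]
  refine Finset.sum_le_sum fun i _ => ?_
  have h1 : T.singularValues (d - 1) ≤ T.singularValues i :=
    T.singularValues_antitone (by omega)
  have h2 := pow_le_pow_left₀ (T.singularValues_nonneg (d - 1)) h1 2
  simp only [Real.norm_eq_abs, sq_abs, conj_trivial]
  nlinarith [mul_le_mul_of_nonneg_right h2 (sq_nonneg (x i))]

theorem abs_det_eq_prod_singularValues {m : ℕ}
    (T : EuclideanSpace ℝ (Fin m) →ₗ[ℝ] EuclideanSpace ℝ (Fin m)) :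
    |LinearMap.det T| = ∏ i ∈ Finset.range m, T.singularValues i := by
  rw [← LinearMap.normDet_eq_abs_det, LinearMap.normDet_eq_prod_singularValues,
    finrank_euclideanSpace_fin]

theorem prod_range_two_mul_le {M : Type*} [CommMonoid M] [Preorder M] [MulLeftMono M] {s : ℕ → M}
    (hs : Antitone s) (n : ℕ) :
    ∏ j ∈ Finset.range (2 * n), s j ≤ (∏ k ∈ Finset.range n, s (2 * k)) ^ 2 := by
  induction n with
  | zero => simp
  | succ n ih =>
    rw [Nat.mul_succ, Finset.prod_range_succ, Finset.prod_range_succ, Finset.prod_range_succ,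
      mul_pow, mul_assoc, sq (s (2 * n))]
    exact mul_le_mul' ih (mul_le_mul_right (hs (Nat.le_succ _)) _)

end SingularValues

/-! ### The determinant estimate -/

section Core

variable {X : Type u} {Y : Type v} [NormedAddCommGroup X] [NormedSpace ℝ X]
  [NormedAddCommGroup Y] [NormedSpace ℝ Y]

/-- By `hlu` the matrix of `T = B ∘ S ∘ U` is lower triangular, so the left side is at most `|det
T|`, the product of singular values. Each pair of consecutive ones is bounded by the square of the
even-indexed one. -/
theorem prod_le_sq_prod_eRan (S : X →L[ℝ] Y) {F : Set X} {n : ℕ} {u : Fin (2 * n) → X}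
    {l : Fin (2 * n) → StrongDual ℝ Y} (hlu : ∀ i j, i < j → l i (S (u j)) = 0) {c : X} {ρ β : ℝ}
    (hρ : 0 < ρ) (hβ : 0 < β)
    (hF : ∀ x : EuclideanSpace ℝ (Fin (2 * n)), ‖x‖ ≤ 1 → c + ρ • ∑ j, x j • u j ∈ F)
    (hl : ∀ y, ∑ i, l i y ^ 2 ≤ β ^ 2 * ‖y‖ ^ 2) :
    ∏ j, ENNReal.ofReal (l j (S (u j))) ≤
      (∏ k ∈ Finset.range n, ENNReal.ofReal (2 * β / ρ) * eRan.{u, v, w} S F k) ^ 2 := by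
  let U : EuclideanSpace ℝ (Fin (2 * n)) →ₗ[ℝ] X :=
    Fintype.linearCombination ℝ u ∘ₗ (WithLp.linearEquiv 2 ℝ (Fin (2 * n) → ℝ)).toLinearMap
  have hU : ∀ x, U x = ∑ j, x j • u j := fun x => rfl
  let B : Y →ₗ[ℝ] EuclideanSpace ℝ (Fin (2 * n)) :=
    (WithLp.linearEquiv 2 ℝ (Fin (2 * n) → ℝ)).symm.toLinearMap ∘ₗ
      LinearMap.pi fun i => (l i).toLinearMap
  have hB : ∀ y i, B y i = l i y := fun y i => rfl
  have hBn : ∀ y, ‖B y‖ ≤ β * ‖y‖ := fun y => by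
    refine le_of_sq_le_sq ?_ (by positivity)
    rw [EuclideanSpace.norm_sq_eq, mul_pow]
    simpa [hB] using hl y
  let T := B ∘ₗ S.toLinearMap ∘ₗ U
  have hdet : LinearMap.det T = ∏ j, l j (S (u j)) := by
    rw [← LinearMap.det_toMatrix (EuclideanSpace.basisFun (Fin (2 * n)) ℝ).toBasis,
      Matrix.det_of_isLowerTriangular]
    · refine Finset.prod_congr rfl fun j _ => ?_
      simp [LinearMap.toMatrix_apply, T, hU, hB, PiLp.single_apply]
    · intro i j hij
      have hij' : i < j := hij
      simpa [LinearMap.toMatrix_apply, T, hU, hB, PiLp.single_apply] using hlu i j hij'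
  have hσ : ∀ k ∈ Finset.range n, ENNReal.ofReal (T.singularValues (2 * k)) ≤
      ENNReal.ofReal (2 * β / ρ) * eRan.{u, v, w} S F k := by
    intro k hk
    rw [Finset.mem_range] at hk
    obtain ⟨J, hJ⟩ := exists_isometry_singularValues_mul_norm_le (d := 2 * k + 1) (by omega)
      (by omega) T
    rw [Nat.add_sub_cancel] at hJ
    set s := T.singularValues (2 * k)
    have h1 := le_eRan_of_ball.{u, v, w} (d := 2 * k + 1) (c := c) (F := F)
      (ι := ρ • (U ∘ₗ J.toLinearMap)) S (σ := ρ * s / β) (by omega)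
      (fun x hx => hF (J x) (by rwa [J.norm_map])) (fun x => by
        have h2 := (hJ x).trans (hBn (S (U (J x))))
        rw [LinearMap.smul_apply, map_smul, norm_smul, Real.norm_of_nonneg hρ.le, mul_div_assoc,
          mul_assoc, div_mul_eq_mul_div]
        gcongr
        rw [div_le_iff₀ hβ, mul_comm _ β]
        exact h2) k
    -- With `d = 2k + 1` the ratio `(d - k) / d = (k + 1) / (2k + 1)` is at least `1/2`.
    have h2 : ((k + 1 : ℕ) : ℝ≥0∞) * ENNReal.ofReal (ρ * s / β) ≤
        ((k + 1 : ℕ) : ℝ≥0∞) * (2 * eRan.{u, v, w} S F k) := by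
      rw [show 2 * k + 1 - k = k + 1 by omega] at h1
      refine h1.trans ?_
      rw [← mul_assoc]
      gcongr
      norm_cast
      omega
    rw [ENNReal.mul_le_mul_iff_right (by simp) (ENNReal.natCast_ne_top _)] at h2
    calc ENNReal.ofReal s = ENNReal.ofReal (β / ρ) * ENNReal.ofReal (ρ * s / β) := by
          rw [← ENNReal.ofReal_mul (by positivity)]
          congr 1
          field_simp
      _ ≤ ENNReal.ofReal (β / ρ) * (2 * eRan.{u, v, w} S F k) := by gcongr
      _ = ENNReal.ofReal (2 * β / ρ) * eRan.{u, v, w} S F k := by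
          rw [mul_div_assoc, ENNReal.ofReal_mul zero_le_two, ENNReal.ofReal_ofNat]
          ring
  calc ∏ j, ENNReal.ofReal (l j (S (u j))) ≤ ∏ j, ENNReal.ofReal |l j (S (u j))| :=
        Finset.prod_le_prod' fun j _ => ENNReal.ofReal_le_ofReal (le_abs_self _)
    _ = ENNReal.ofReal |LinearMap.det T| := by
        rw [hdet, Finset.abs_prod, ENNReal.ofReal_prod_of_nonneg fun _ _ => abs_nonneg _]
    _ = ∏ j ∈ Finset.range (2 * n), ENNReal.ofReal (T.singularValues j) := by
        rw [abs_det_eq_prod_singularValues,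
          ENNReal.ofReal_prod_of_nonneg fun i _ => T.singularValues_nonneg i]
    _ ≤ (∏ k ∈ Finset.range n, ENNReal.ofReal (T.singularValues (2 * k))) ^ 2 :=
        prod_range_two_mul_le
          (fun i j hij => ENNReal.ofReal_le_ofReal (T.singularValues_antitone hij)) n
    _ ≤ _ := by gcongr with k hk; exact hσ k hk

end Core

/-- Products in `[0, ∞]` can be approached from strictly below factor by factor; a zero factor makes
the claim trivial. The strict inequalities let the errors be witnessed by actual pairs. -/
theorem prod_le_of_forall_lt {m : ℕ} {d : ℕ → ℝ≥0∞} {R : ℝ≥0∞}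
    (h : ∀ a : ℕ → ℝ≥0∞, (∀ k < m, a k < d k) → ∏ k ∈ Finset.range m, a k ≤ R) :
    ∏ k ∈ Finset.range m, d k ≤ R := by
  induction m generalizing R with
  | zero => exact h d (by simp)
  | succ m ih =>
    rw [Finset.prod_range_succ]
    refine ENNReal.mul_le_of_forall_lt fun p hp b hb => ?_
    obtain ⟨a, ha, hpa⟩ : ∃ a : ℕ → ℝ≥0∞, (∀ k < m, a k < d k) ∧
        p < ∏ k ∈ Finset.range m, a k := by
      by_contra! hcon
      exact hp.not_ge (ih hcon)
    have h1 := h (Function.update a m b) fun k hk => by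
      rcases eq_or_ne k m with rfl | hkm
      · simpa using hb
      · rw [Function.update_of_ne hkm]
        exact ha k (by omega)
    rw [Finset.prod_range_succ, Function.update_self] at h1
    refine le_trans ?_ h1
    gcongr
    refine hpa.le.trans_eq (Finset.prod_congr rfl fun k hk => ?_)
    rw [Function.update_of_ne (Finset.mem_range.1 hk).ne]

/-! ### From products to geometric means -/

section GeomMean

theorem geomMean_le_mul_geomMean {p n : ℕ} (hp : p ≠ 0) (hn : n ≠ 0) {d e : ℕ → ℝ≥0∞} {K : ℝ≥0∞}
    (h : ∏ k ∈ Finset.range (p * n), d k ≤ (∏ k ∈ Finset.range n, K * e k) ^ p) :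
    geomMean (p * n) d ≤ K * geomMean n e := by
  have hp' : (p : ℝ) ≠ 0 := by exact_mod_cast hp
  have hn' : (n : ℝ) ≠ 0 := by exact_mod_cast hn
  unfold geomMean
  calc (∏ k ∈ Finset.range (p * n), d k) ^ (1 / ((p * n : ℕ) : ℝ))
      ≤ ((∏ k ∈ Finset.range n, K * e k) ^ p) ^ (1 / ((p * n : ℕ) : ℝ)) := by gcongr
    _ = (∏ k ∈ Finset.range n, K * e k) ^ (1 / (n : ℝ)) := by
        rw [← ENNReal.rpow_natCast, ← ENNReal.rpow_mul]
        congr 1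
        push_cast
        field_simp
    _ = K * (∏ k ∈ Finset.range n, e k) ^ (1 / (n : ℝ)) := by
        rw [Finset.prod_mul_distrib, Finset.prod_const, Finset.card_range,
          ENNReal.mul_rpow_of_nonneg _ _ (by positivity), ← ENNReal.rpow_natCast,
          ← ENNReal.rpow_mul, mul_one_div_cancel hn', ENNReal.rpow_one]

theorem le_geomMean_of_antitone {d : ℕ → ℝ≥0∞} (hd : Antitone d) {m : ℕ} (hm : m ≠ 0) :
    d (m - 1) ≤ geomMean m d := by
  have hm' : (m : ℝ) ≠ 0 := by exact_mod_cast hm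
  have h : d (m - 1) ^ m ≤ ∏ k ∈ Finset.range m, d k := by
    rw [← Finset.card_range m, ← Finset.prod_const, Finset.card_range]
    exact Finset.prod_le_prod' fun k hk => hd (by have := Finset.mem_range.1 hk; omega)
  calc d (m - 1) = (d (m - 1) ^ m) ^ (1 / (m : ℝ)) := by
        rw [← ENNReal.rpow_natCast, ← ENNReal.rpow_mul, mul_one_div_cancel hm', ENNReal.rpow_one]
    _ ≤ _ := by unfold geomMean; gcongr

theorem two_rpow_le_twelve : (2 : ℝ≥0∞) ^ (7 / 2 : ℝ) ≤ 12 := by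
  -- Squared, the claim is `128 ≤ 144`.
  have h : ((2 : ℝ≥0∞) ^ (7 / 2 : ℝ)) ^ (2 : ℝ) ≤ 12 ^ (2 : ℝ) := by
    rw [← ENNReal.rpow_mul, show (7 / 2 : ℝ) * 2 = (7 : ℕ) by norm_num, ENNReal.rpow_natCast,
      ENNReal.rpow_ofNat]
    norm_num
  exact (ENNReal.rpow_le_rpow_iff (by norm_num)).1 h

theorem geomMean_le_and_last_le {p n : ℕ} (hp : p ≠ 0) (hn : n ≠ 0) {d e : ℕ → ℝ≥0∞}
    (hd : Antitone d) {K q : ℝ≥0∞} (hK : K ≤ 2 ^ (7 / 2 : ℝ) * q)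
    (h : ∏ k ∈ Finset.range (p * n), d k ≤ (∏ k ∈ Finset.range n, K * e k) ^ p) :
    geomMean (p * n) d ≤ 2 ^ (7 / 2 : ℝ) * q * geomMean n e ∧
      d (p * n - 1) ≤ 12 * q * geomMean n e := by
  have h1 : geomMean (p * n) d ≤ 2 ^ (7 / 2 : ℝ) * q * geomMean n e :=
    (geomMean_le_mul_geomMean hp hn h).trans (by gcongr)
  refine ⟨h1, (le_geomMean_of_antitone hd (mul_ne_zero hp hn)).trans (h1.trans ?_)⟩
  gcongr
  exact two_rpow_le_twelve

end GeomMean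

/-! ### Greedy pairs from non-adaptive errors -/

section Deterministic

variable {X : Type u} {Y : Type v} [NormedAddCommGroup X] [NormedSpace ℝ X]

theorem IsNonadaptiveAlg.mono {F : Set X} {n m : ℕ} (hnm : n ≤ m) {A : F → Y}
    (hA : IsNonadaptiveAlg F n A) : IsNonadaptiveAlg F m A := by
  obtain ⟨L, φ, h⟩ := hA
  refine ⟨fun i => if hi : (i : ℕ) < n then L ⟨i, hi⟩ else 0,
    fun y => φ fun i => y (Fin.castLE hnm i), fun f => ?_⟩
  rw [h]
  simp

variable [NormedAddCommGroup Y]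

theorem eDetNon_antitone (S : X → Y) (F : Set X) : Antitone (eDetNon S F) := fun _ _ hnm =>
  le_iInf fun A => iInf_le_of_le ⟨A.1, A.2.mono hnm⟩ le_rfl

-- Otherwise, answering with `S g` for any `g ∈ F` having the observed data would give error at most
-- `a`.
open Classical in
theorem exists_pair_of_lt_eDetNon {S : X → Y} {F : Set X} {ι : Type*} [Fintype ι]
    (L : ι → StrongDual ℝ X) {a : ℝ≥0∞} (ha : a < eDetNon S F (Fintype.card ι)) :
    ∃ f ∈ F, ∃ g ∈ F, (∀ i, L i f = L i g) ∧ a < ‖S f - S g‖ₑ := by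
  by_contra! hcon
  refine ha.not_ge ?_
  let e := (Fintype.equivFin ι).symm
  let N : F → Fin (Fintype.card ι) → ℝ := fun f i => L (e i) f
  let φ : (Fin (Fintype.card ι) → ℝ) → Y := fun y =>
    if h : ∃ g : F, N g = y then S (h.choose : X) else 0
  refine iInf_le_of_le ⟨fun f => φ (N f), fun i => L (e i), φ, fun f => rfl⟩ (iSup_le fun f => ?_)
  have h : ∃ g : F, N g = N f := ⟨f, rfl⟩
  simp only [φ, h, dif_pos]
  refine hcon f f.2 _ h.choose.2 fun i => ?_
  have := congrFun h.choose_spec (e.symm i)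
  simpa [N] using this.symm

/-- Each earlier pair contributes `r` functionals, so the `j`-th choice faces `r * j` fixed
measurements. -/
theorem exists_greedy_pairs {S : X → Y} {F : Set X} {r : ℕ} (G : X → Fin r → StrongDual ℝ X)
    {m : ℕ} {a : ℕ → ℝ≥0∞} (ha : ∀ j < m, a j < eDetNon S F (r * j)) :
    ∃ f g : ℕ → X, ∀ j < m, f j ∈ F ∧ g j ∈ F ∧ a j < ‖S (f j) - S (g j)‖ₑ ∧
      ∀ i < j, ∀ s, G (f i - g i) s (f j - g j) = 0 := by
  induction m with
  | zero => exact ⟨0, 0, by simp⟩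
  | succ m ih =>
    obtain ⟨f, g, h⟩ := ih fun j hj => ha j (by omega)
    have hm := ha m (by omega)
    rw [show r * m = Fintype.card (Fin r × Fin m) by simp] at hm
    obtain ⟨x, hx, y, hy, hL, hxy⟩ :=
      exists_pair_of_lt_eDetNon (fun p : Fin r × Fin m => G (f p.2 - g p.2) p.1) hm
    refine ⟨Function.update f m x, Function.update g m y, fun j hj => ?_⟩
    rcases Nat.lt_succ_iff_lt_or_eq.1 hj with hj | rfl
    · obtain ⟨h1, h2, h3, h4⟩ := h j hj
      rw [Function.update_of_ne hj.ne, Function.update_of_ne hj.ne]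
      refine ⟨h1, h2, h3, fun i hi s => ?_⟩
      rw [Function.update_of_ne (hi.trans hj).ne, Function.update_of_ne (hi.trans hj).ne]
      exact h4 i hi s
    · rw [Function.update_self, Function.update_self]
      refine ⟨hx, hy, hxy, fun i hi s => ?_⟩
      rw [Function.update_of_ne hi.ne, Function.update_of_ne hi.ne, map_sub, sub_eq_zero]
      exact hL (s, ⟨i, hi⟩)

variable [NormedSpace ℝ Y]

/-- `G u` lists what later differences must annihilate: enough to force triangularity (`hG`), and
possibly more to help place a larger ball in `F` (`hF`). -/
theorem prod_eDetNon_le (S : X →L[ℝ] Y) {F : Set X} {n r : ℕ} {Λ : Y → StrongDual ℝ Y}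
    (hΛ : ∀ y, Λ y y = ‖y‖) {β ρ : ℝ} (hβ : 0 < β) (hρ : 0 < ρ)
    (hΛβ : ∀ v : Fin (2 * n) → Y, (∀ j, v j ≠ 0) → (∀ i j, i < j → Λ (v i) (v j) = 0) →
      ∀ y, ∑ i, Λ (v i) y ^ 2 ≤ β ^ 2 * ‖y‖ ^ 2)
    (G : X → Fin r → StrongDual ℝ X)
    (hG : ∀ u u', (∀ s, G u s u' = 0) → Λ (S u) (S u') = 0)
    (hF : ∀ f g : Fin (2 * n) → X, (∀ j, f j ∈ F) → (∀ j, g j ∈ F) →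
      (∀ i j, i < j → ∀ s, G (f i - g i) s (f j - g j) = 0) →
      ∃ c : X, ∀ x : EuclideanSpace ℝ (Fin (2 * n)), ‖x‖ ≤ 1 →
        c + ρ • ∑ j, x j • (f j - g j) ∈ F) :
    ∏ j ∈ Finset.range (2 * n), eDetNon S F (r * j) ≤
      (∏ k ∈ Finset.range n, ENNReal.ofReal (2 * β / ρ) * eRan.{u, v, w} S F k) ^ 2 := by
  refine prod_le_of_forall_lt fun a ha => ?_
  obtain ⟨f, g, h⟩ := exists_greedy_pairs G ha
  let u : Fin (2 * n) → X := fun j => f j - g j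
  have hu : ∀ i j : Fin (2 * n), i < j → ∀ s, G (u i) s (u j) = 0 := fun i j hij =>
    (h j j.2).2.2.2 i hij
  have hau : ∀ j : Fin (2 * n), a j < ‖S (u j)‖ₑ := fun j => by
    simpa [u] using (h j j.2).2.2.1
  obtain ⟨c, hc⟩ := hF (fun j => f j) (fun j => g j) (fun j => (h j j.2).1)
    (fun j => (h j j.2).2.1) hu
  refine le_trans ?_ (prod_le_sq_prod_eRan S (u := u) (l := fun i => Λ (S (u i)))
    (fun i j hij => hG _ _ (hu i j hij)) hρ hβ hc
    (hΛβ _ (fun j hj => by simpa [hj] using hau j) fun i j hij => hG _ _ (hu i j hij)))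
  rw [Finset.prod_range]
  refine Finset.prod_le_prod' fun j _ => ?_
  rw [hΛ, ofReal_norm]
  exact (hau j).le

end Deterministic

/-! ### Euclidean balls inside convex sets -/

section Geometry

variable {X : Type u} [NormedAddCommGroup X] [NormedSpace ℝ X] {F : Set X} {m : ℕ}
  {f g : Fin m → X}

/-- Move independently along each segment from `g j` to `f j`, with parameter `x j ∈ [-1, 1]`, and
average the `m` points. -/
theorem exists_ball_of_pairs (hF : Convex ℝ F) (hm : 0 < m) (hf : ∀ j, f j ∈ F)
    (hg : ∀ j, g j ∈ F) : ∃ c : X, ∀ x : EuclideanSpace ℝ (Fin m), ‖x‖ ≤ 1 →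
      c + (1 / (2 * m) : ℝ) • ∑ j, x j • (f j - g j) ∈ F := by
  have hm' : (m : ℝ) ≠ 0 := by positivity
  refine ⟨(1 / (2 * m) : ℝ) • ∑ j, (f j + g j), fun x hx => ?_⟩
  have hxj : ∀ j, |x j| ≤ 1 := fun j => (PiLp.norm_apply_le x j).trans hx
  have h1 : ∀ j, ((1 + x j) / 2) • f j + ((1 - x j) / 2) • g j ∈ F := fun j =>
    hF (hf j) (hg j) (by linarith [(abs_le.1 (hxj j)).1]) (by linarith [(abs_le.1 (hxj j)).2])
      (by ring)
  have h2 := hF.sum_mem (t := Finset.univ) (w := fun _ : Fin m => (1 / m : ℝ))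
    (fun _ _ => by positivity) (by simp [hm']) (fun j _ => h1 j)
  convert h2 using 1
  rw [← smul_add, ← Finset.sum_add_distrib, Finset.smul_sum]
  refine Finset.sum_congr rfl fun j _ => ?_
  match_scalars <;> ring

theorem sum_smul_mem_of_symmetric (hF : Convex ℝ F) (hs : ∀ x ∈ F, -x ∈ F) (hne : F.Nonempty)
    {ι : Type*} {s : Finset ι} {t : ι → ℝ} {v : ι → X} (hv : ∀ i ∈ s, v i ∈ F)
    (ht : ∑ i ∈ s, |t i| ≤ 1) : ∑ i ∈ s, t i • v i ∈ F := by
  have h0 : (0 : X) ∈ F := by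
    obtain ⟨x, hx⟩ := hne
    have := hF hx (hs x hx) (a := 1 / 2) (b := 1 / 2) (by norm_num) (by norm_num) (by norm_num)
    simpa using this
  have h1 : ∀ i ∈ s, (SignType.sign (t i) : ℝ) • v i ∈ F := fun i hi => by
    rcases lt_trichotomy (t i) 0 with h | h | h
    · simpa [h] using hs _ (hv i hi)
    · simpa [h] using h0
    · simpa [h] using hv i hi
  rcases (Finset.sum_nonneg fun i (_ : i ∈ s) => abs_nonneg (t i)).eq_or_lt with h | h
  · have h2 : ∀ i ∈ s, t i • v i = 0 := fun i hi => by
      rw [abs_eq_zero.1 ((Finset.sum_eq_zero_iff_of_nonneg fun i _ => abs_nonneg (t i)).1 h.symm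
        i hi), zero_smul]
    rwa [Finset.sum_eq_zero h2]
  · have h2 := hF.smul_mem_of_zero_mem h0
      (hF.centerMass_mem (w := fun i => |t i|) (fun i _ => abs_nonneg _) h h1) ⟨h.le, ht⟩
    rw [Finset.centerMass, smul_smul, mul_inv_cancel₀ h.ne', one_smul] at h2
    convert h2 using 2 with i hi
    rw [smul_smul, mul_comm, sign_mul_abs]

/-- Symmetry puts `(f j - g j) / 2` in `F`, so `F` contains their absolutely convex combinations;
Cauchy–Schwarz bounds the `ℓ¹` norm by `√m`. -/
theorem exists_ball_of_pairs_of_symmetric (hF : Convex ℝ F) (hs : ∀ x ∈ F, -x ∈ F)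
    (hm : 0 < m) (hf : ∀ j, f j ∈ F) (hg : ∀ j, g j ∈ F) :
    ∃ c : X, ∀ x : EuclideanSpace ℝ (Fin m), ‖x‖ ≤ 1 →
      c + (1 / (2 * √m) : ℝ) • ∑ j, x j • (f j - g j) ∈ F := by
  have hm' : 0 < √(m : ℝ) := by positivity
  refine ⟨0, fun x hx => ?_⟩
  have h1 : ∀ j, (1 / 2 : ℝ) • (f j - g j) ∈ F := fun j => by
    have := hF (hf j) (hs _ (hg j)) (a := 1 / 2) (b := 1 / 2) (by norm_num) (by norm_num)
      (by norm_num)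
    rwa [smul_neg, ← sub_eq_add_neg, ← smul_sub] at this
  have h2 : ∑ j, |x j| ≤ √m := by
    refine Real.le_sqrt_of_sq_le ?_
    have := sq_sum_le_card_mul_sum_sq (s := Finset.univ) (f := fun j => |x j|)
    simp only [sq_abs, Finset.card_univ, Fintype.card_fin] at this
    refine this.trans ?_
    have h3 : ∑ j, x j ^ 2 ≤ 1 := by
      have := EuclideanSpace.norm_sq_eq x
      simp only [Real.norm_eq_abs, sq_abs] at this
      rw [← this]
      exact pow_le_one₀ (norm_nonneg _) hx
    nlinarith [Nat.cast_nonneg (α := ℝ) m]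
  have h3 := sum_smul_mem_of_symmetric hF hs ⟨_, hf ⟨0, hm⟩⟩ (s := Finset.univ)
    (t := fun j => x j / √m) (fun j _ => h1 j) (by
      simp only [abs_div, abs_of_pos hm', ← Finset.sum_div]
      rwa [div_le_one hm'])
  convert h3 using 1
  rw [zero_add, Finset.smul_sum]
  refine Finset.sum_congr rfl fun j _ => ?_
  rw [smul_smul, smul_smul]
  congr 1
  field_simp

end Geometry

/-! ### Norming functionals and Hilbert space improvements -/

section Hilbert

theorem IsHilbertNorm.restrictScalars {𝕜 E : Type*} [RCLike 𝕜] [NormedAddCommGroup E]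
    [NormedSpace 𝕜 E] [NormedSpace ℝ E] [IsScalarTower ℝ 𝕜 E] (h : IsHilbertNorm 𝕜 E) :
    IsHilbertNorm ℝ E := by
  obtain ⟨ip, hip⟩ := h
  subst hip
  refine ⟨InnerProductSpace.rclikeToReal 𝕜 E, ?_⟩
  ext r x
  exact algebraMap_smul 𝕜 r x

variable {Y : Type v} [NormedAddCommGroup Y] [NormedSpace ℝ Y]

theorem exists_norming_functionals (m : ℕ) : ∃ Λ : Y → StrongDual ℝ Y, (∀ y, Λ y y = ‖y‖) ∧
    ∀ v : Fin m → Y, ∀ y, ∑ i, Λ (v i) y ^ 2 ≤ √m ^ 2 * ‖y‖ ^ 2 := by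
  choose Λ h1 h2 using fun y : Y => exists_dual_vector'' ℝ y
  refine ⟨Λ, fun y => by simpa using h2 y, fun v y => ?_⟩
  calc ∑ i, Λ (v i) y ^ 2 ≤ ∑ _i : Fin m, ‖y‖ ^ 2 := by
        refine Finset.sum_le_sum fun i _ => ?_
        rw [← sq_abs]
        exact pow_le_pow_left₀ (abs_nonneg _) (((Λ (v i)).le_of_opNorm_le (h1 _) y).trans_eq
          (one_mul _)) 2
    _ = _ := by rw [Real.sq_sqrt (Nat.cast_nonneg m)]; simp

/-- Here the norming functional is the inner product with `y / ‖y‖`. Triangularity then means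
orthogonality of the `v j`, and Bessel's inequality replaces the trivial `√m` by `1`. -/
theorem IsHilbertNorm.exists_norming_functionals (h : IsHilbertNorm ℝ Y) (m : ℕ) :
    ∃ Λ : Y → StrongDual ℝ Y, (∀ y, Λ y y = ‖y‖) ∧
    ∀ v : Fin m → Y, (∀ j, v j ≠ 0) → (∀ i j, i < j → Λ (v i) (v j) = 0) →
      ∀ y, ∑ i, Λ (v i) y ^ 2 ≤ 1 ^ 2 * ‖y‖ ^ 2 := by
  obtain ⟨ip, hip⟩ := h
  subst hip
  refine ⟨fun y => innerSL ℝ (‖y‖⁻¹ • y), fun y => ?_, fun v hv hvo y => ?_⟩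
  · rw [innerSL_apply_apply, inner_smul_left, real_inner_self_eq_norm_sq]
    rcases eq_or_ne ‖y‖ 0 with h | h
    · simp [h]
    · simp only [conj_trivial]
      field_simp
  · have ho : Orthonormal ℝ fun i => ‖v i‖⁻¹ • v i := by
      refine ⟨fun i => norm_smul_inv_norm (𝕜 := ℝ) (hv i), fun i j hij => ?_⟩
      rcases lt_or_gt_of_ne hij with h | h
      · have := hvo i j h
        rw [innerSL_apply_apply] at this
        rw [inner_smul_right, this, mul_zero]
      · have := hvo j i h
        rw [innerSL_apply_apply] at this
        rw [real_inner_comm, inner_smul_right, this, mul_zero]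
    have := ho.sum_inner_products_le y (s := Finset.univ)
    simpa only [Real.norm_eq_abs, sq_abs, innerSL_apply_apply, one_pow, one_mul] using this

/-- Differences of points of the unit ball have norm at most `2`; if they are orthogonal, Pythagoras
gives radius `1/2` in every dimension. -/
theorem IsHilbertNorm.exists_orthogonality_functionals (h : IsHilbertNorm ℝ Y) :
    ∃ I : Y → StrongDual ℝ Y, ∀ {m : ℕ} (f g : Fin m → Y),
      (∀ j, f j ∈ Metric.closedBall (0 : Y) 1) → (∀ j, g j ∈ Metric.closedBall (0 : Y) 1) →
      (∀ i j, i < j → I (f i - g i) (f j - g j) = 0) →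
      ∀ x : EuclideanSpace ℝ (Fin m), ‖x‖ ≤ 1 →
        (0 : Y) + (1 / 2 : ℝ) • ∑ j, x j • (f j - g j) ∈ Metric.closedBall (0 : Y) 1 := by
  obtain ⟨ip, hip⟩ := h
  subst hip
  refine ⟨fun y => innerSL ℝ y, fun {m} f g hf hg hfg x hx => ?_⟩
  have ho : Pairwise fun i j => inner ℝ (x i • (f i - g i)) (x j • (f j - g j)) = 0 := by
    intro i j hij
    rw [inner_smul_left, inner_smul_right]
    rcases lt_or_gt_of_ne hij with h | h
    · have := hfg i j h
      rw [innerSL_apply_apply] at this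
      rw [this, mul_zero, mul_zero]
    · have := hfg j i h
      rw [innerSL_apply_apply] at this
      rw [real_inner_comm, this, mul_zero, mul_zero]
  have h1 : ‖∑ j, x j • (f j - g j)‖ ^ 2 = ∑ j, ‖x j • (f j - g j)‖ ^ 2 := by
    rw [← real_inner_self_eq_norm_sq, sum_inner]
    refine Finset.sum_congr rfl fun i _ => ?_
    rw [inner_sum, Finset.sum_eq_single i (fun j _ hj => ho hj.symm) (by simp),
      real_inner_self_eq_norm_sq]
  have h2 : ‖∑ j, x j • (f j - g j)‖ ≤ 2 := by
    refine le_of_sq_le_sq ?_ zero_le_two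
    rw [h1]
    calc ∑ j, ‖x j • (f j - g j)‖ ^ 2 ≤ ∑ j, ‖x j‖ ^ 2 * 2 ^ 2 := by
          refine Finset.sum_le_sum fun j _ => ?_
          rw [norm_smul, mul_pow]
          gcongr
          have h3 := hf j
          have h4 := hg j
          rw [mem_closedBall_zero_iff] at h3 h4
          linarith [norm_sub_le (f j) (g j)]
      _ = ‖x‖ ^ 2 * 2 ^ 2 := by rw [EuclideanSpace.norm_sq_eq, Finset.sum_mul]
      _ ≤ 2 ^ 2 := by nlinarith [norm_nonneg x]
  rw [mem_closedBall_zero_iff, zero_add, norm_smul, Real.norm_of_nonneg (by norm_num)]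
  linarith

end Hilbert

/-! ### Constants in the individual cases -/

section Bounds

theorem ofReal_le_two_rpow_mul_natCast_rpow {c q : ℝ} (hq : 0 ≤ q) {n : ℕ} {s : ℝ}
    (hc : s ≤ 2 ^ c * (n : ℝ) ^ q) :
    ENNReal.ofReal s ≤ 2 ^ c * (n : ℝ≥0∞) ^ q := by
  refine (ENNReal.ofReal_le_ofReal hc).trans_eq ?_
  rw [ENNReal.ofReal_mul (by positivity), ← ENNReal.ofReal_rpow_of_pos two_pos,
    ← ENNReal.ofReal_rpow_of_nonneg (Nat.cast_nonneg n) hq, ENNReal.ofReal_natCast,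
    ENNReal.ofReal_ofNat]

theorem two_rpow_seven_half : (2 : ℝ) ^ (7 / 2 : ℝ) = 8 * √2 := by
  rw [show (7 / 2 : ℝ) = 3 + 1 / 2 by norm_num, Real.rpow_add two_pos, ← Real.sqrt_eq_rpow]
  norm_num

theorem rpow_three_half (x : ℝ) (hx : 0 ≤ x) : x ^ (3 / 2 : ℝ) = x * √x := by
  rw [show (3 / 2 : ℝ) = 1 + 1 / 2 by norm_num, Real.rpow_add_of_nonneg hx zero_le_one (by norm_num),
    ← Real.sqrt_eq_rpow, Real.rpow_one]

variable {X : Type u} {Y : Type v} [NormedAddCommGroup X] [NormedSpace ℝ X]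
  [NormedAddCommGroup Y] [NormedSpace ℝ Y] (S : X →L[ℝ] Y) {F : Set X} {n : ℕ}

theorem bounds_of_ball (hn : 1 ≤ n) {Λ : Y → StrongDual ℝ Y} (hΛ : ∀ y, Λ y y = ‖y‖) {β ρ : ℝ}
    (hβ : 0 < β) (hρ : 0 < ρ)
    (hΛβ : ∀ v : Fin (2 * n) → Y, (∀ j, v j ≠ 0) → (∀ i j, i < j → Λ (v i) (v j) = 0) →
      ∀ y, ∑ i, Λ (v i) y ^ 2 ≤ β ^ 2 * ‖y‖ ^ 2)
    (hF : ∀ f g : Fin (2 * n) → X, (∀ j, f j ∈ F) → (∀ j, g j ∈ F) →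
      ∃ c : X, ∀ x : EuclideanSpace ℝ (Fin (2 * n)), ‖x‖ ≤ 1 →
        c + ρ • ∑ j, x j • (f j - g j) ∈ F) {q : ℝ} (hq : 0 ≤ q)
    (hc : 2 * β / ρ ≤ 2 ^ (7 / 2 : ℝ) * (n : ℝ) ^ q) :
    geomMean (2 * n) (eDetNon S F) ≤
        2 ^ (7 / 2 : ℝ) * (n : ℝ≥0∞) ^ q * geomMean n (eRan.{u, v, w} S F) ∧
      eDetNon S F (2 * n - 1) ≤ 12 * (n : ℝ≥0∞) ^ q * geomMean n (eRan.{u, v, w} S F) := by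
  refine geomMean_le_and_last_le two_ne_zero (by omega) (eDetNon_antitone S F)
    (ofReal_le_two_rpow_mul_natCast_rpow hq hc) ?_
  have := prod_eDetNon_le.{u, v, w} S hΛ hβ hρ hΛβ (fun u (_ : Fin 1) => (Λ (S u)).comp S)
    (fun u u' h => h 0) (fun f g hf hg _ => hF f g hf hg)
  simpa only [one_mul] using this

theorem bounds_convex (hF : Convex ℝ F) (hn : 1 ≤ n) :
    geomMean (2 * n) (eDetNon S F) ≤
        2 ^ (7 / 2 : ℝ) * (n : ℝ≥0∞) ^ (3 / 2 : ℝ) * geomMean n (eRan.{u, v, w} S F) ∧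
      eDetNon S F (2 * n - 1) ≤
        12 * (n : ℝ≥0∞) ^ (3 / 2 : ℝ) * geomMean n (eRan.{u, v, w} S F) := by
  have hn' : (0 : ℝ) < n := by exact_mod_cast hn
  obtain ⟨Λ, hΛ, hΛβ⟩ := exists_norming_functionals (Y := Y) (2 * n)
  -- Here `2β/ρ = 8n √(2n)`, which is exactly `2^(7/2) n^(3/2)`; in the other cases the constant has
  -- slack.
  refine bounds_of_ball S hn hΛ (β := √(2 * n : ℕ)) (ρ := 1 / (2 * (2 * n : ℕ)))
    (by positivity) (by positivity) (fun v _ _ => hΛβ v)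
    (fun f g hf hg => exists_ball_of_pairs hF (by omega) hf hg) (by norm_num) (le_of_eq ?_)
  rw [two_rpow_seven_half, rpow_three_half _ hn'.le]
  push_cast
  rw [Real.sqrt_mul zero_le_two]
  field_simp
  norm_num

theorem bounds_symmetric (hF : Convex ℝ F) (hs : ∀ x ∈ F, -x ∈ F) (hn : 1 ≤ n) :
    geomMean (2 * n) (eDetNon S F) ≤
        2 ^ (7 / 2 : ℝ) * (n : ℝ≥0∞) * geomMean n (eRan.{u, v, w} S F) ∧
      eDetNon S F (2 * n - 1) ≤ 12 * (n : ℝ≥0∞) * geomMean n (eRan.{u, v, w} S F) := by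
  obtain ⟨Λ, hΛ, hΛβ⟩ := exists_norming_functionals (Y := Y) (2 * n)
  have := bounds_of_ball.{u, v, w} S hn hΛ (β := √(2 * n : ℕ)) (ρ := 1 / (2 * √(2 * n : ℕ)))
    (by positivity) (by positivity) (fun v _ _ => hΛβ v)
    (fun f g hf hg => exists_ball_of_pairs_of_symmetric hF hs (by omega) hf hg) zero_le_one (by
      rw [two_rpow_seven_half, Real.rpow_one]
      have h1 : √(2 * n : ℕ) * √(2 * n : ℕ) = 2 * n := by
        rw [Real.mul_self_sqrt (Nat.cast_nonneg _)]; push_cast; ring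
      have h2 : 1 ≤ √(2 : ℝ) := Real.one_le_sqrt.2 one_le_two
      rw [div_div_eq_mul_div, div_one]
      nlinarith)
  simpa only [ENNReal.rpow_one] using this

theorem bounds_hilbert_target (hF : Convex ℝ F) (hY : IsHilbertNorm ℝ Y) (hn : 1 ≤ n) :
    geomMean (2 * n) (eDetNon S F) ≤
        2 ^ (7 / 2 : ℝ) * (n : ℝ≥0∞) * geomMean n (eRan.{u, v, w} S F) ∧
      eDetNon S F (2 * n - 1) ≤ 12 * (n : ℝ≥0∞) * geomMean n (eRan.{u, v, w} S F) := by
  obtain ⟨Λ, hΛ, hΛβ⟩ := hY.exists_norming_functionals (2 * n)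
  have := bounds_of_ball.{u, v, w} S hn hΛ (β := 1) (ρ := 1 / (2 * (2 * n : ℕ)))
    one_pos (by positivity) hΛβ
    (fun f g hf hg => exists_ball_of_pairs hF (by omega) hf hg) zero_le_one (by
      rw [two_rpow_seven_half, Real.rpow_one]
      have h2 : 1 ≤ √(2 : ℝ) := Real.one_le_sqrt.2 one_le_two
      rw [div_div_eq_mul_div, div_one]
      push_cast
      nlinarith)
  simpa only [ENNReal.rpow_one] using this

theorem bounds_symmetric_hilbert_target (hF : Convex ℝ F) (hs : ∀ x ∈ F, -x ∈ F)
    (hY : IsHilbertNorm ℝ Y) (hn : 1 ≤ n) :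
    geomMean (2 * n) (eDetNon S F) ≤
        2 ^ (7 / 2 : ℝ) * (n : ℝ≥0∞) ^ (1 / 2 : ℝ) * geomMean n (eRan.{u, v, w} S F) ∧
      eDetNon S F (2 * n - 1) ≤
        12 * (n : ℝ≥0∞) ^ (1 / 2 : ℝ) * geomMean n (eRan.{u, v, w} S F) := by
  obtain ⟨Λ, hΛ, hΛβ⟩ := hY.exists_norming_functionals (2 * n)
  refine bounds_of_ball S hn hΛ (β := 1) (ρ := 1 / (2 * √(2 * n : ℕ)))
    one_pos (by positivity) hΛβ
    (fun f g hf hg => exists_ball_of_pairs_of_symmetric hF hs (by omega) hf hg) (by norm_num) ?_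
  rw [two_rpow_seven_half, ← Real.sqrt_eq_rpow, div_div_eq_mul_div, div_one]
  push_cast
  rw [Real.sqrt_mul zero_le_two]
  nlinarith [mul_nonneg (Real.sqrt_nonneg 2) (Real.sqrt_nonneg n)]

/-- Making the differences orthogonal costs a second functional per pair, so only errors of even
index `2 * j` appear; monotonicity fills in the odd ones, whence `4 * n` on the left. -/
theorem bounds_hilbert_source (hX : IsHilbertNorm ℝ X) (hn : 1 ≤ n) :
    geomMean (4 * n) (eDetNon S (Metric.closedBall 0 1)) ≤
        2 ^ (7 / 2 : ℝ) * (n : ℝ≥0∞) ^ (1 / 2 : ℝ) *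
          geomMean n (eRan.{u, v, w} S (Metric.closedBall 0 1)) ∧
      eDetNon S (Metric.closedBall 0 1) (4 * n - 1) ≤
        12 * (n : ℝ≥0∞) ^ (1 / 2 : ℝ) *
          geomMean n (eRan.{u, v, w} S (Metric.closedBall 0 1)) := by
  obtain ⟨Λ, hΛ, hΛβ⟩ := exists_norming_functionals (Y := Y) (2 * n)
  obtain ⟨I, hI⟩ := hX.exists_orthogonality_functionals
  have hc : 2 * √(2 * n : ℕ) / (1 / 2) ≤ 2 ^ (7 / 2 : ℝ) * (n : ℝ) ^ (1 / 2 : ℝ) := by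
    rw [two_rpow_seven_half, ← Real.sqrt_eq_rpow, div_div_eq_mul_div, div_one]
    push_cast
    rw [Real.sqrt_mul zero_le_two]
    nlinarith [mul_nonneg (Real.sqrt_nonneg 2) (Real.sqrt_nonneg n)]
  refine geomMean_le_and_last_le four_ne_zero (by omega) (eDetNon_antitone S _)
    (ofReal_le_two_rpow_mul_natCast_rpow (by norm_num) hc) ?_
  have h := prod_eDetNon_le.{u, v, w} S (F := Metric.closedBall 0 1) (β := √(2 * n : ℕ)) hΛ
    (by positivity) (by norm_num : (0 : ℝ) < 1 / 2) (fun v _ _ => hΛβ v)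
    (fun u => ![(Λ (S u)).comp S, I u]) (fun u u' h => h 0)
    (fun f g hf hg hfg => ⟨0, hI f g hf hg fun i j hij => hfg i j hij 1⟩)
  calc ∏ k ∈ Finset.range (4 * n), eDetNon S (Metric.closedBall 0 1) k
      = ∏ k ∈ Finset.range (2 * (2 * n)), eDetNon S (Metric.closedBall 0 1) k := by
        rw [show 4 * n = 2 * (2 * n) by ring]
    _ ≤ (∏ j ∈ Finset.range (2 * n), eDetNon S (Metric.closedBall 0 1) (2 * j)) ^ 2 :=
        prod_range_two_mul_le (eDetNon_antitone S _) (2 * n)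
    _ ≤ _ := by
        rw [show 4 = 2 * 2 from rfl, pow_mul]
        gcongr

end Bounds

end LinearInfo

theorem mainTheorem1 {𝕜 : Type*} [RCLike 𝕜]
    {X : Type u} [NormedAddCommGroup X] [NormedSpace 𝕜 X] [NormedSpace ℝ X]
    [IsScalarTower ℝ 𝕜 X] [CompleteSpace X]
    {Y : Type v} [NormedAddCommGroup Y] [NormedSpace 𝕜 Y] [CompleteSpace Y]
    (S : X →L[𝕜] Y) (F : Set X) (hF : Convex ℝ F) (n : ℕ) (hn : 1 ≤ n) :
    (LinearInfo.geomMean (2 * n) (LinearInfo.eDetNon S F) ≤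
          2 ^ (7 / 2 : ℝ) * (n : ℝ≥0∞) ^ (3 / 2 : ℝ)
            * LinearInfo.geomMean n (LinearInfo.eRan.{u, v, w} S F) ∧
      LinearInfo.eDetNon S F (2 * n - 1) ≤
          12 * (n : ℝ≥0∞) ^ (3 / 2 : ℝ)
            * LinearInfo.geomMean n (LinearInfo.eRan.{u, v, w} S F)) ∧
    ((∀ x ∈ F, -x ∈ F) →
      LinearInfo.geomMean (2 * n) (LinearInfo.eDetNon S F) ≤
          2 ^ (7 / 2 : ℝ) * (n : ℝ≥0∞)
            * LinearInfo.geomMean n (LinearInfo.eRan.{u, v, w} S F) ∧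
      LinearInfo.eDetNon S F (2 * n - 1) ≤
          12 * (n : ℝ≥0∞)
            * LinearInfo.geomMean n (LinearInfo.eRan.{u, v, w} S F)) ∧
    (LinearInfo.IsHilbertNorm 𝕜 Y →
      LinearInfo.geomMean (2 * n) (LinearInfo.eDetNon S F) ≤
          2 ^ (7 / 2 : ℝ) * (n : ℝ≥0∞)
            * LinearInfo.geomMean n (LinearInfo.eRan.{u, v, w} S F) ∧
      LinearInfo.eDetNon S F (2 * n - 1) ≤
          12 * (n : ℝ≥0∞)
            * LinearInfo.geomMean n (LinearInfo.eRan.{u, v, w} S F)) ∧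
    ((∀ x ∈ F, -x ∈ F) → LinearInfo.IsHilbertNorm 𝕜 Y →
      LinearInfo.geomMean (2 * n) (LinearInfo.eDetNon S F) ≤
          2 ^ (7 / 2 : ℝ) * (n : ℝ≥0∞) ^ (1 / 2 : ℝ)
            * LinearInfo.geomMean n (LinearInfo.eRan.{u, v, w} S F) ∧
      LinearInfo.eDetNon S F (2 * n - 1) ≤
          12 * (n : ℝ≥0∞) ^ (1 / 2 : ℝ)
            * LinearInfo.geomMean n (LinearInfo.eRan.{u, v, w} S F)) ∧
    (LinearInfo.IsHilbertNorm 𝕜 X → F = Metric.closedBall 0 1 →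
      LinearInfo.geomMean (4 * n) (LinearInfo.eDetNon S F) ≤
          2 ^ (7 / 2 : ℝ) * (n : ℝ≥0∞) ^ (1 / 2 : ℝ)
            * LinearInfo.geomMean n (LinearInfo.eRan.{u, v, w} S F) ∧
      LinearInfo.eDetNon S F (4 * n - 1) ≤
          12 * (n : ℝ≥0∞) ^ (1 / 2 : ℝ)
            * LinearInfo.geomMean n (LinearInfo.eRan.{u, v, w} S F)) := by
  -- Measurements are real-linear, so only the real structures matter from here on.
  let _ : NormedSpace ℝ Y := NormedSpace.restrictScalars ℝ 𝕜 Y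
  have _ : IsScalarTower ℝ 𝕜 Y := IsScalarTower.of_algebraMap_smul fun _ _ => rfl
  let T : X →L[ℝ] Y := S.restrictScalars ℝ
  refine ⟨LinearInfo.bounds_convex T hF hn,
    fun hs => LinearInfo.bounds_symmetric T hF hs hn,
    fun hY => LinearInfo.bounds_hilbert_target T hF hY.restrictScalars hn,
    fun hs hY => LinearInfo.bounds_symmetric_hilbert_target T hF hs hY.restrictScalars hn, ?_⟩
  rintro hX rfl
  exact LinearInfo.bounds_hilbert_source T hX.restrictScalars hn
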